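/- There is an absolute constant $C>0$ such that for all integers $d\ge 1$, $1\le s\le d$ and $k\ge 0$, $$\left\| \int \psi^{\otimes k}\, d\mu(\psi) \;-\; \mathop{\mathbb{E}}_{S\subseteq[d],\ |S|=s} \phi_S^{\otimes k} \right\|_1 \;\le\; C\left(\frac{k^2}{d}+\frac{k}{\sqrt{s}}+\frac{sk}{d}\right).$$ Here $\mu$ is the Haar measure on pure states, i.e. the uniform probability measure on the unit sphere of $\mathbb{C}^d$; $\psi=|\psi\rangle\langle\psi|$ is the density operator of the unit vector $|\psi\rangle$; the expectation is over a uniformly random $s$-element subset $S$ of $[d]=\{1,\dots,d\}$; $\phi_S=|\phi_S\rangle\langle\phi_S|$ is the density operator of the subset state $|\phi_S\rangle=\frac{1}{\sqrt{s}}\sum_{i\in S}|i\rangle$; and $\|\cdot\|_1$ is the trace norm, the sum of the singular values (the trace distance of two states is half the trace norm of their difference). -/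

import Mathlib

open MeasureTheory

noncomputable section

/-- The uniform probability measure on the unit sphere of `ℂ^d` (the Haar measure on pure states):
the surface measure induced by the Lebesgue measure of `ℂ^d`, normalized to total mass one. -/
def uniformSphere (d : ℕ) : Measure (Metric.sphere (0 : EuclideanSpace ℂ (Fin d)) 1) :=
  ((volume : Measure (EuclideanSpace ℂ (Fin d))).toSphere Set.univ)⁻¹ •
    (volume : Measure (EuclideanSpace ℂ (Fin d))).toSphere

/-- The operator `|ψ⟩⟨ψ|`, as a matrix in the standard basis. -/
def ketbra {d : ℕ} (ψ : EuclideanSpace ℂ (Fin d)) : Matrix (Fin d) (Fin d) ℂ :=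
  Matrix.vecMulVec ψ.ofLp (star ψ.ofLp)

/-- The tensor (Kronecker) power `A^{⊗k}` on `(ℂ^d)^{⊗k}`, as a matrix in the standard basis
`|i₁ … i_k⟩`, which is indexed by the `k`-tuples `i : Fin k → Fin d`. -/
def tensorPow {d : ℕ} (k : ℕ) (A : Matrix (Fin d) (Fin d) ℂ) :
    Matrix (Fin k → Fin d) (Fin k → Fin d) ℂ :=
  Matrix.of fun i j => ∏ l, A (i l) (j l)

/-- The subset state `|φ_S⟩ = |S|^{-1/2} ∑_{i ∈ S} |i⟩`. -/
def subsetKet {d : ℕ} (S : Finset (Fin d)) : EuclideanSpace ℂ (Fin d) :=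
  ((1 / Real.sqrt (S.card : ℝ) : ℝ) : ℂ) • ∑ i ∈ S, EuclideanSpace.single i (1 : ℂ)

/-- The `k`-copy Haar moment `∫ ψ^{⊗k} dμ(ψ)`; a matrix-valued integral is taken entrywise. -/
def haarMoment (d k : ℕ) : Matrix (Fin k → Fin d) (Fin k → Fin d) ℂ :=
  Matrix.of fun i j => ∫ ψ, tensorPow k (ketbra (ψ : EuclideanSpace ℂ (Fin d))) i j
    ∂(uniformSphere d)

/-- The average of `φ_S^{⊗k}` over all `s`-element subsets `S` of `[d]`. -/
def subsetMoment (d s k : ℕ) : Matrix (Fin k → Fin d) (Fin k → Fin d) ℂ :=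
  ((Finset.powersetCard s (Finset.univ : Finset (Fin d))).card : ℂ)⁻¹ •
    ∑ S ∈ Finset.powersetCard s (Finset.univ : Finset (Fin d)), tensorPow k (ketbra (subsetKet S))

/-- The trace norm `‖A‖₁` of a square matrix: the sum of its singular values. -/
def traceNorm {n : Type*} [Fintype n] [DecidableEq n] (A : Matrix n n ℂ) : ℝ :=
  ∑ r ∈ Finset.range (Fintype.card n), (Matrix.toEuclideanLin A).singularValues r

end

open scoped ComplexOrder Matrix

/-! For positive semidefinite `X`, `Y` the trace norm of `X - Y` is at most `tr X + tr Y`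
(`traceNorm_sub_le`), so it is enough to write the difference of the two moments as a difference of
positive semidefinite matrices of small trace. Both moments are compared with multiples of one
matrix `G = typeMatrix d k`, which lives on the injective tuples.

Haar side: by invariance under sign flips and permutations of coordinates, the moment equals `c • G`
on injective tuples and has no entries linking these to the others. The remainder is positive, and
its trace is the probability that `k` samples from the distribution `|ψ_a|²` collide, which is
`O(k²/d)` by a fourth moment bound (`exists_posSemidef_haarMoment_sub`).

Subset side: restricting each `φ_S^{⊗k}` to injective tuples costs `O(k/√s)`
(`exists_posSemidef_subsetMoment_sub`). An entry of the restricted average `P` at tuples with entry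
sets `I`, `J` depends only on `|I ∩ J|`. Vandermonde's identity expands it over `R ⊆ I ∩ J` with
nonnegative coefficients, so `P` is a positive combination of rank-one matrices indexed by `R`. The
terms with `|R| = k` sum to `l • G`, and they carry all but `O(k²/s + sk/d)` of the trace
(`one_sub_trace_smul_typeMatrix_le`).

Since `c · tr G` and `l · tr G` are both close to 1 from below, `|c - l| · tr G` is small too.
Outside the range where these estimates apply, the trivial bound 2 suffices. -/

/-! ### Trace norm of a difference of positive matrices -/

/-- Singular value decomposition: `e` diagonalises `T* T`, the vectors `T (e i)` are then
orthogonal, and `f` extends the normalised nonzero ones. -/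
theorem LinearMap.exists_orthonormalBasis_apply_eq_singularValues_smul {E : Type*}
    [NormedAddCommGroup E] [InnerProductSpace ℂ E] [FiniteDimensional ℂ E] {n : ℕ}
    (hn : Module.finrank ℂ E = n) (T : E →ₗ[ℂ] E) :
    ∃ e f : OrthonormalBasis (Fin n) ℂ E,
      ∀ i, T (e i) = ((T.singularValues i : ℝ) : ℂ) • f i := by
  have hS := T.isSymmetric_adjoint_comp_self
  set e := hS.eigenvectorBasis hn with he
  have hinner : ∀ i j, inner ℂ (T (e i)) (T (e j)) =
      if i = j then (((T.singularValues i : ℝ) : ℂ)) ^ 2 else 0 := by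
    intro i j
    rw [← LinearMap.adjoint_inner_right, ← LinearMap.comp_apply, he,
      hS.apply_eigenvectorBasis hn j, inner_smul_right, ← T.sq_singularValues_fin hn,
      OrthonormalBasis.inner_eq_ite]
    split_ifs with h
    · subst h; simp
    · simp
  let s : Set (Fin n) := {i | T.singularValues i ≠ 0}
  let v : Fin n → E := fun i => (((T.singularValues i : ℝ) : ℂ))⁻¹ • T (e i)
  have hv : Orthonormal ℂ (s.domRestrict v) := by
    rw [orthonormal_iff_ite]
    rintro ⟨i, hi⟩ ⟨j, hj⟩
    have hi' : ((T.singularValues i : ℝ) : ℂ) ≠ 0 := by exact_mod_cast hi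
    simp only [Set.domRestrict_apply, v, inner_smul_left, inner_smul_right, hinner,
      Subtype.mk.injEq]
    split_ifs with h
    · subst h
      simp only [map_inv₀, Complex.conj_ofReal]
      field_simp
    · simp
  obtain ⟨f, hf⟩ := hv.exists_orthonormalBasis_extension_of_card_eq (by simpa using hn)
  refine ⟨e, f, fun i => ?_⟩
  by_cases hi : T.singularValues i = 0
  · have h0 := hinner i i
    simp only [if_true, hi, Complex.ofReal_zero, ne_eq, OfNat.ofNat_ne_zero, not_false_eq_true,
      zero_pow, inner_self_eq_zero] at h0
    simp [h0, hi]
  · have hi' : ((T.singularValues i : ℝ) : ℂ) ≠ 0 := by exact_mod_cast hi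
    rw [hf i hi]
    simp [v, hi']

theorem LinearMap.IsPositive.two_mul_re_inner_le {E : Type*}
    [NormedAddCommGroup E] [InnerProductSpace ℂ E] {X : E →ₗ[ℂ] E}
    (hX : X.IsPositive) (e f : E) :
    2 * (inner ℂ f (X e)).re ≤ (inner ℂ f (X f)).re + (inner ℂ e (X e)).re := by
  have h := hX.re_inner_nonneg_right (f - e)
  have hs : (inner ℂ e (X f)).re = (inner ℂ f (X e)).re := by
    rw [← hX.isSymmetric, ← inner_conj_symm, Complex.conj_re]
  simp only [map_sub, inner_sub_left, inner_sub_right, RCLike.re_to_complex] at h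
  linarith

/-- Each singular value is `⟨f i, (X - Y) e i⟩`. Positivity of `X` at `f i - e i` and of `Y` at `f i
+ e i` bounds it by diagonal terms, which sum to traces in either basis. -/
theorem traceNorm_sub_le {n : Type*} [Fintype n] [DecidableEq n] {X Y : Matrix n n ℂ}
    (hX : X.PosSemidef) (hY : Y.PosSemidef) :
    traceNorm (X - Y) ≤ X.trace.re + Y.trace.re := by
  have hn : Module.finrank ℂ (EuclideanSpace ℂ n) = Fintype.card n := by simp
  obtain ⟨e, f, hef⟩ :=
    (Matrix.toEuclideanLin (X - Y)).exists_orthonormalBasis_apply_eq_singularValues_smul hn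
  have tr : ∀ (Z : Matrix n n ℂ) (b : OrthonormalBasis (Fin (Fintype.card n)) ℂ
      (EuclideanSpace ℂ n)), Z.trace.re = ∑ i, (inner ℂ (b i) (Matrix.toEuclideanLin Z (b i))).re := by
    intro Z b
    rw [← Complex.re_sum, ← LinearMap.trace_eq_sum_inner, Matrix.toEuclideanLin_eq_toLin_orthonormal,
      Matrix.trace_toLin_eq]
  have hX' := Matrix.isPositive_toEuclideanLin_iff.2 hX
  have hY' := Matrix.isPositive_toEuclideanLin_iff.2 hY
  have key : ∀ i : Fin (Fintype.card n),
      2 * (Matrix.toEuclideanLin (X - Y)).singularValues i ≤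
      ((inner ℂ (f i) (Matrix.toEuclideanLin X (f i))).re +
        (inner ℂ (e i) (Matrix.toEuclideanLin X (e i))).re) +
      ((inner ℂ (f i) (Matrix.toEuclideanLin Y (f i))).re +
        (inner ℂ (e i) (Matrix.toEuclideanLin Y (e i))).re) := by
    intro i
    have h1 := hX'.two_mul_re_inner_le (e i) (f i)
    have h2 := hY'.two_mul_re_inner_le (-e i) (f i)
    have h3 : (inner ℂ (f i) (Matrix.toEuclideanLin (X - Y) (e i))).re =
        (Matrix.toEuclideanLin (X - Y)).singularValues i := by
      rw [hef, inner_smul_right]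
      simp
    rw [map_sub, LinearMap.sub_apply, inner_sub_right, Complex.sub_re] at h3
    simp only [map_neg, inner_neg_left, inner_neg_right, Complex.neg_re, neg_neg] at h2
    rw [map_sub]
    linarith
  have hsum := Finset.sum_le_sum fun i (_ : i ∈ Finset.univ) => key i
  rw [← Finset.mul_sum, Finset.sum_add_distrib, Finset.sum_add_distrib, Finset.sum_add_distrib,
    ← tr, ← tr, ← tr, ← tr] at hsum
  rw [traceNorm, Finset.sum_range]
  linarith

/-! ### Unitary invariance of the measure on the sphere -/

section Sphere

variable {E : Type*} [NormedAddCommGroup E] [InnerProductSpace ℝ E] [FiniteDimensional ℝ E]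
  [MeasurableSpace E] [BorelSpace E]

/-- The homeomorphism of the unit sphere induced by a linear isometry. -/
def LinearIsometryEquiv.sphereHomeomorph (f : E ≃ₗᵢ[ℝ] E) :
    Metric.sphere (0 : E) 1 ≃ₜ Metric.sphere (0 : E) 1 :=
  f.toHomeomorph.subtype fun x => by simp

/-- `toSphere` measures a set by the volume of the cone over it, up to a dimensional factor; a
linear isometry carries cones to cones and preserves volume. -/
theorem LinearIsometryEquiv.measurePreserving_toSphere (f : E ≃ₗᵢ[ℝ] E) :
    MeasurePreserving f.sphereHomeomorph (volume : Measure E).toSphere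
      (volume : Measure E).toSphere := by
  refine ⟨f.sphereHomeomorph.continuous.measurable, ?_⟩
  ext s hs
  rw [Measure.map_apply f.sphereHomeomorph.continuous.measurable hs,
    Measure.toSphere_apply' _ hs,
    Measure.toSphere_apply' _ (f.sphereHomeomorph.continuous.measurable hs)]
  congr 1
  refine Eq.trans ?_ (f.measurePreserving.measure_preimage_equiv (f := f.toMeasurableEquiv) _)
  congr 1
  ext x
  simp only [Set.mem_smul, Set.mem_image, Set.mem_preimage, Subtype.exists]
  constructor
  · rintro ⟨r, hr, _, ⟨y, hy, hys, rfl⟩, rfl⟩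
    exact ⟨r, hr, f y, ⟨f y, by simpa using hy, hys, rfl⟩, by simp⟩
  · rintro ⟨r, hr, _, ⟨y, hy, hys, rfl⟩, hx⟩
    refine ⟨r, hr, f.symm y, ⟨f.symm y, by simpa using hy, ?_, rfl⟩, ?_⟩
    · convert hys
      exact f.apply_symm_apply y
    · rw [← map_smul, hx]
      exact f.symm_apply_apply x

end Sphere

instance (d : ℕ) [NeZero d] : IsProbabilityMeasure (uniformSphere d) := by
  refine ⟨?_⟩
  rw [uniformSphere, Measure.smul_apply, smul_eq_mul]
  refine ENNReal.inv_mul_cancel ?_ (measure_ne_top _ _)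
  rw [Measure.measure_univ_ne_zero]
  exact Measure.toSphere_ne_zero _

theorem integral_uniformSphere_comp {d : ℕ}
    (f : EuclideanSpace ℂ (Fin d) ≃ₗᵢ[ℂ] EuclideanSpace ℂ (Fin d)) {F : Type*}
    [NormedAddCommGroup F] [NormedSpace ℝ F] (g : EuclideanSpace ℂ (Fin d) → F) :
    ∫ ψ, g (f ψ.1) ∂uniformSphere d = ∫ ψ, g ψ.1 ∂uniformSphere d := by
  let f' : EuclideanSpace ℂ (Fin d) ≃ₗᵢ[ℝ] EuclideanSpace ℂ (Fin d) :=
    { f.toLinearEquiv.restrictScalars ℝ with norm_map' := f.norm_map }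
  have h : MeasurePreserving f'.sphereHomeomorph (uniformSphere d) (uniformSphere d) :=
    f'.measurePreserving_toSphere.smul_measure _
  exact h.integral_comp f'.sphereHomeomorph.measurableEmbedding fun ψ => g ψ.1

theorem integrable_uniformSphere {d : ℕ} [NeZero d] {F : Type*} [NormedAddCommGroup F]
    {g : EuclideanSpace ℂ (Fin d) → F} (hg : Continuous g) :
    Integrable (fun ψ : Metric.sphere (0 : EuclideanSpace ℂ (Fin d)) 1 => g ψ.1)
      (uniformSphere d) :=
  (hg.comp continuous_subtype_val).integrable_of_hasCompactSupport
    (HasCompactSupport.of_compactSpace _)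

theorem sum_normSq_sphere {d : ℕ} (ψ : Metric.sphere (0 : EuclideanSpace ℂ (Fin d)) 1) :
    ∑ a, ‖ψ.1 a‖ ^ 2 = 1 := by
  rw [← EuclideanSpace.norm_sq_eq, norm_eq_of_mem_sphere, one_pow]

/-! ### Birthday bound -/

/-- Union bound over pairs of positions: two independent samples from `w` coincide with probability
`∑ a, w a ^ 2`. -/
theorem sum_prod_of_not_injective_le {α : Type*} [Fintype α] [DecidableEq α] {w : α → ℝ}
    (hw : ∀ a, 0 ≤ w a) (hw1 : ∑ a, w a = 1) (k : ℕ) :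
    ∑ i : Fin k → α with ¬ Function.Injective i, ∏ l, w (i l) ≤ k ^ 2 * ∑ a, w a ^ 2 := by
  have hpair : ∀ p ∈ (Finset.univ : Finset (Fin k)).offDiag,
      ∑ i : Fin k → α, (if i p.1 = i p.2 then ∏ l, w (i l) else 0) = ∑ a, w a ^ 2 := by
    rintro ⟨l, l'⟩ hp
    have hne : l ≠ l' := by simpa using hp
    -- Splitting by the common value `a` turns the collision indicator into products over positions,
    -- so the sum over tuples factors.
    have h1 : ∀ i : Fin k → α, (if i l = i l' then ∏ m, w (i m) else 0) =
        ∑ a, ∏ m, (if m ∈ ({l, l'} : Finset (Fin k)) then (if i m = a then w (i m) else 0)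
          else w (i m)) := by
      intro i
      have h2 : ∀ a, ∏ m, (if m ∈ ({l, l'} : Finset (Fin k)) then
          (if i m = a then w (i m) else 0) else w (i m)) =
          if i l = a then (if i l' = a then ∏ m, w (i m) else 0) else 0 := by
        intro a
        split_ifs with h3 h4
        · refine Finset.prod_congr rfl fun m _ => ?_
          split_ifs with h5 h6
          · rfl
          · rcases (by simpa using h5 : m = l ∨ m = l') with rfl | rfl <;> contradiction
          · rfl
        · exact Finset.prod_eq_zero (Finset.mem_univ l') (by simp [h4])
        · exact Finset.prod_eq_zero (Finset.mem_univ l) (by simp [h3])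
      simp only [h2, Finset.sum_ite_eq, Finset.mem_univ, if_true]
      simp only [eq_comm]
    simp only [h1]
    rw [Finset.sum_comm]
    refine Finset.sum_congr rfl fun a _ => ?_
    have h3 := Finset.prod_univ_sum (fun _ : Fin k => (Finset.univ : Finset α))
      (fun m x => if m ∈ ({l, l'} : Finset (Fin k)) then (if x = a then w x else 0) else w x)
    rw [Fintype.piFinset_univ] at h3
    rw [← h3]
    have h4 : ∀ m : Fin k, ∑ x, (if m ∈ ({l, l'} : Finset (Fin k)) then
        (if x = a then w x else 0) else w x) = if m ∈ ({l, l'} : Finset (Fin k)) then w a else 1 := by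
      intro m
      split_ifs
      · simp
      · exact hw1
    simp only [h4]
    rw [Finset.prod_ite_mem, Finset.univ_inter, Finset.prod_const, Finset.card_pair hne]
  calc ∑ i : Fin k → α with ¬ Function.Injective i, ∏ l, w (i l)
      ≤ ∑ i : Fin k → α, ∑ p ∈ (Finset.univ : Finset (Fin k)).offDiag,
          (if i p.1 = i p.2 then ∏ l, w (i l) else 0) := by
        rw [Finset.sum_filter]
        refine Finset.sum_le_sum fun i _ => ?_
        have hnn : ∀ p ∈ (Finset.univ : Finset (Fin k)).offDiag,
            0 ≤ (if i p.1 = i p.2 then ∏ l, w (i l) else 0) := fun p _ => by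
          split_ifs
          exacts [Finset.prod_nonneg fun l _ => hw _, le_rfl]
        split_ifs with hi
        · exact Finset.sum_nonneg hnn
        · simp only [Function.Injective, not_forall] at hi
          obtain ⟨l, l', h, hne⟩ := hi
          have := Finset.single_le_sum hnn (a := (l, l')) (by simpa using hne)
          simpa [h] using this
    _ = ((Finset.univ : Finset (Fin k)).offDiag.card : ℝ) * ∑ a, w a ^ 2 := by
        rw [Finset.sum_comm, Finset.sum_congr rfl hpair, Finset.sum_const, nsmul_eq_mul]
    _ ≤ k ^ 2 * ∑ a, w a ^ 2 := by
        refine mul_le_mul_of_nonneg_right ?_ (Finset.sum_nonneg fun a _ => sq_nonneg _)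
        rw [Finset.offDiag_card, Finset.card_fin]
        exact_mod_cast (Nat.sub_le _ _).trans (by rw [sq])

/-! ### Tensor powers: positivity and trace -/

/-- The vector `ψ^{⊗k}` in the standard basis. -/
def tensorKet {d : ℕ} (k : ℕ) (ψ : EuclideanSpace ℂ (Fin d)) : (Fin k → Fin d) → ℂ :=
  fun i => ∏ l, ψ (i l)

theorem tensorPow_ketbra {d k : ℕ} (ψ : EuclideanSpace ℂ (Fin d)) :
    tensorPow k (ketbra ψ) = Matrix.vecMulVec (tensorKet k ψ) (star (tensorKet k ψ)) := by
  ext i j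
  simp [tensorPow, ketbra, tensorKet, Matrix.vecMulVec_apply, Finset.prod_mul_distrib]

theorem tensorPow_ketbra_apply {d k : ℕ} (ψ : EuclideanSpace ℂ (Fin d)) (i j : Fin k → Fin d) :
    tensorPow k (ketbra ψ) i j = (∏ l, ψ (i l)) * ∏ l, star (ψ (j l)) := by
  simp [tensorPow_ketbra, Matrix.vecMulVec_apply, tensorKet]

theorem tensorPow_ketbra_self {d k : ℕ} (ψ : EuclideanSpace ℂ (Fin d)) (i : Fin k → Fin d) :
    tensorPow k (ketbra ψ) i i = ((∏ l, ‖ψ (i l)‖ ^ 2 : ℝ) : ℂ) := by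
  rw [tensorPow_ketbra_apply, ← Finset.prod_mul_distrib, Complex.ofReal_prod]
  exact Finset.prod_congr rfl fun l _ => by
    rw [Complex.star_def, Complex.mul_conj, Complex.normSq_eq_norm_sq]

theorem posSemidef_tensorPow_ketbra {d k : ℕ} (ψ : EuclideanSpace ℂ (Fin d)) :
    (tensorPow k (ketbra ψ)).PosSemidef := by
  rw [tensorPow_ketbra]
  exact Matrix.posSemidef_vecMulVec_self_star _

theorem trace_tensorPow_ketbra {d k : ℕ} {ψ : EuclideanSpace ℂ (Fin d)}
    (hψ : ∑ a, ‖ψ a‖ ^ 2 = 1) : (tensorPow k (ketbra ψ)).trace = 1 := by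
  simp only [Matrix.trace, Matrix.diag, tensorPow_ketbra_self]
  rw [← Complex.ofReal_sum, ← Fintype.sum_pow (fun a => ‖ψ a‖ ^ 2), hψ]
  simp

theorem continuous_tensorPow_ketbra {d k : ℕ} (i j : Fin k → Fin d) :
    Continuous fun ψ : EuclideanSpace ℂ (Fin d) => tensorPow k (ketbra ψ) i j := by
  simp only [tensorPow_ketbra_apply]
  fun_prop

theorem posSemidef_haarMoment (d k : ℕ) [NeZero d] : (haarMoment d k).PosSemidef := by
  refine Matrix.PosSemidef.of_dotProduct_mulVec_nonneg ?_ fun x => ?_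
  · ext i j
    simp only [Matrix.conjTranspose_apply, haarMoment, Matrix.of_apply, Complex.star_def]
    rw [← integral_conj]
    refine integral_congr_ae (.of_forall fun ψ => ?_)
    exact (posSemidef_tensorPow_ketbra (k := k) ψ.1).isHermitian.apply i j
  · have h : star x ⬝ᵥ haarMoment d k *ᵥ x =
        ∫ ψ, star x ⬝ᵥ tensorPow k (ketbra ψ.1) *ᵥ x ∂uniformSphere d := by
      simp only [dotProduct, Matrix.mulVec, haarMoment, Matrix.of_apply]
      have hint : ∀ i j, Integrable (fun ψ : Metric.sphere (0 : EuclideanSpace ℂ (Fin d)) 1 =>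
          tensorPow k (ketbra ψ.1) i j) (uniformSphere d) := fun i j =>
        integrable_uniformSphere (continuous_tensorPow_ketbra i j)
      rw [integral_finsetSum _ fun i _ => (integrable_finsetSum _ fun j _ =>
        (hint i j).mul_const _).const_mul _]
      refine Finset.sum_congr rfl fun i _ => ?_
      rw [integral_const_mul, integral_finsetSum _ fun j _ => (hint i j).mul_const _]
      simp only [integral_mul_const]
    rw [h]
    exact integral_nonneg fun ψ => (posSemidef_tensorPow_ketbra ψ.1).dotProduct_mulVec_nonneg x

theorem haarMoment_self (d k : ℕ) (i : Fin k → Fin d) :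
    haarMoment d k i i = ((∫ ψ, ∏ l, ‖ψ.1 (i l)‖ ^ 2 ∂uniformSphere d : ℝ) : ℂ) := by
  simp only [haarMoment, Matrix.of_apply, tensorPow_ketbra_self]
  exact integral_ofReal

theorem trace_haarMoment (d k : ℕ) [NeZero d] : (haarMoment d k).trace = 1 := by
  simp only [Matrix.trace, Matrix.diag, haarMoment, Matrix.of_apply]
  rw [← integral_finsetSum _ fun i _ =>
    integrable_uniformSphere (continuous_tensorPow_ketbra i i)]
  have : ∀ ψ : Metric.sphere (0 : EuclideanSpace ℂ (Fin d)) 1,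
      ∑ i, tensorPow k (ketbra ψ.1) i i = 1 := fun ψ =>
    trace_tensorPow_ketbra (sum_normSq_sphere ψ)
  simp [this]

/-! ### Fourth moments of the coordinates of a Haar random state -/

/-- The isometry acting by `(x, y) ↦ ((x + y) / √2, (x - y) / √2)` on the coordinates `a ≠ b`. -/
noncomputable def hadamardIsometry {d : ℕ} {a b : Fin d} (hab : a ≠ b) :
    EuclideanSpace ℂ (Fin d) ≃ₗᵢ[ℂ] EuclideanSpace ℂ (Fin d) :=
  LinearIsometry.toLinearIsometryEquiv
    { toFun := fun ψ => WithLp.toLp 2 fun c =>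
        if c = a then ((√2 : ℝ) : ℂ)⁻¹ * (ψ a + ψ b)
        else if c = b then ((√2 : ℝ) : ℂ)⁻¹ * (ψ a - ψ b) else ψ c
      map_add' := fun ψ φ => by
        ext c
        simp only [PiLp.add_apply]
        split_ifs <;> ring
      map_smul' := fun r ψ => by
        ext c
        simp only [PiLp.smul_apply, smul_eq_mul, RingHom.id_apply]
        split_ifs <;> ring
      norm_map' := fun ψ => by
        have h : ∀ x y : ℂ, ‖((√2 : ℝ) : ℂ)⁻¹ * (x + y)‖ ^ 2 + ‖((√2 : ℝ) : ℂ)⁻¹ * (x - y)‖ ^ 2 =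
            ‖x‖ ^ 2 + ‖y‖ ^ 2 := by
          intro x y
          simp only [norm_mul, mul_pow, norm_inv, Complex.norm_real, Real.norm_eq_abs, sq_abs,
            inv_pow, Real.sq_sqrt zero_le_two]
          have := parallelogram_law_with_norm ℝ x y
          linarith
        refine (sq_eq_sq₀ (norm_nonneg _) (norm_nonneg _)).1 ?_
        rw [EuclideanSpace.norm_sq_eq, EuclideanSpace.norm_sq_eq, ← sub_eq_zero,
          ← Finset.sum_sub_distrib, Finset.sum_eq_add a b hab]
        · have := h (ψ a) (ψ b)
          simp only [LinearMap.coe_mk, AddHom.coe_mk, if_true, hab.symm, if_false]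
          linarith
        · rintro c - ⟨hca, hcb⟩
          simp [hca, hcb]
        · simp
        · simp } rfl

theorem hadamardIsometry_apply {d : ℕ} {a b : Fin d} (hab : a ≠ b)
    (ψ : EuclideanSpace ℂ (Fin d)) (c : Fin d) :
    hadamardIsometry hab ψ c = if c = a then ((√2 : ℝ) : ℂ)⁻¹ * (ψ a + ψ b)
      else if c = b then ((√2 : ℝ) : ℂ)⁻¹ * (ψ a - ψ b) else ψ c := rfl

theorem norm_pow_four_add_norm_pow_four_le (x y : ℂ) :
    ‖((√2 : ℝ) : ℂ)⁻¹ * (x + y)‖ ^ 4 + ‖((√2 : ℝ) : ℂ)⁻¹ * (x - y)‖ ^ 4 ≤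
      (‖x‖ ^ 4 + ‖y‖ ^ 4) / 2 + 3 * (‖x‖ ^ 2 * ‖y‖ ^ 2) := by
  have h4 : ∀ z : ℂ, ‖z‖ ^ 4 = (‖z‖ ^ 2) ^ 2 := fun z => by ring
  have h2 : ∀ z : ℂ, ‖((√2 : ℝ) : ℂ)⁻¹ * z‖ ^ 2 = ‖z‖ ^ 2 / 2 := fun z => by
    simp only [norm_mul, mul_pow, norm_inv, Complex.norm_real, Real.norm_eq_abs, sq_abs,
      inv_pow, Real.sq_sqrt zero_le_two]
    ring
  simp only [h4, h2]
  simp only [← Complex.normSq_eq_norm_sq, Complex.normSq_apply, Complex.add_re, Complex.add_im,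
    Complex.sub_re, Complex.sub_im]
  -- This square is the defect `|x|²|y|² - (Re x ȳ)²` in Cauchy–Schwarz.
  nlinarith [sq_nonneg (x.re * y.im - x.im * y.re)]

/-- Invariance under `hadamardIsometry` gives `E|ψ_a|⁴ + E|ψ_b|⁴ ≤ 6 E|ψ_a|²|ψ_b|²`. Summed over all
pairs the right side is 6, because `∑ |ψ_a|² = 1`, and the left side is `2d` times the sum to be
bounded. -/
theorem sum_integral_norm_pow_four_le (d : ℕ) [NeZero d] :
    ∑ a, ∫ ψ, ‖ψ.1 a‖ ^ 4 ∂uniformSphere d ≤ 3 / d := by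
  have hint : ∀ a, Integrable (fun ψ : Metric.sphere (0 : EuclideanSpace ℂ (Fin d)) 1 =>
      ‖ψ.1 a‖ ^ 4) (uniformSphere d) := fun a =>
    integrable_uniformSphere (g := fun ψ => ‖ψ a‖ ^ 4) (by fun_prop)
  have hint2 : ∀ a b, Integrable (fun ψ : Metric.sphere (0 : EuclideanSpace ℂ (Fin d)) 1 =>
      ‖ψ.1 a‖ ^ 2 * ‖ψ.1 b‖ ^ 2) (uniformSphere d) := fun a b =>
    integrable_uniformSphere (g := fun ψ => ‖ψ a‖ ^ 2 * ‖ψ b‖ ^ 2) (by fun_prop)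
  have hpair : ∀ a b, ∫ ψ, ‖ψ.1 a‖ ^ 4 ∂uniformSphere d + ∫ ψ, ‖ψ.1 b‖ ^ 4 ∂uniformSphere d ≤
      6 * ∫ ψ, ‖ψ.1 a‖ ^ 2 * ‖ψ.1 b‖ ^ 2 ∂uniformSphere d := by
    intro a b
    by_cases hab : a = b
    · subst hab
      have h : 0 ≤ ∫ ψ, ‖ψ.1 a‖ ^ 4 ∂uniformSphere d := integral_nonneg fun ψ => by positivity
      simp only [← pow_add]
      norm_num
      linarith
    · have h1 := integral_uniformSphere_comp (hadamardIsometry hab) fun ψ => ‖ψ a‖ ^ 4 + ‖ψ b‖ ^ 4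
      have h2 : ∫ ψ, (‖hadamardIsometry hab ψ.1 a‖ ^ 4 + ‖hadamardIsometry hab ψ.1 b‖ ^ 4)
          ∂uniformSphere d ≤ ∫ ψ, ((‖ψ.1 a‖ ^ 4 + ‖ψ.1 b‖ ^ 4) / 2 +
            3 * (‖ψ.1 a‖ ^ 2 * ‖ψ.1 b‖ ^ 2)) ∂uniformSphere d := by
        refine integral_mono (integrable_uniformSphere (g := fun ψ =>
          ‖hadamardIsometry hab ψ a‖ ^ 4 + ‖hadamardIsometry hab ψ b‖ ^ 4) ?_)
          ((((hint a).add (hint b)).div_const 2).add ((hint2 a b).const_mul 3)) fun ψ => ?_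
        · have := (hadamardIsometry hab).continuous
          fun_prop
        · simp only [hadamardIsometry_apply, if_true, if_neg (Ne.symm hab)]
          exact norm_pow_four_add_norm_pow_four_le _ _
      have h3 := integral_add (((hint a).add (hint b)).div_const 2) ((hint2 a b).const_mul 3)
      simp only [Pi.add_apply] at h3
      rw [h1, h3, integral_div, integral_add (hint a) (hint b), integral_const_mul] at h2
      linarith
  have hone : ∑ a, ∑ b, ∫ ψ, ‖ψ.1 a‖ ^ 2 * ‖ψ.1 b‖ ^ 2 ∂uniformSphere d = 1 := by
    have : ∀ a, ∑ b, ∫ ψ, ‖ψ.1 a‖ ^ 2 * ‖ψ.1 b‖ ^ 2 ∂uniformSphere d =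
        ∫ ψ, ∑ b, ‖ψ.1 a‖ ^ 2 * ‖ψ.1 b‖ ^ 2 ∂uniformSphere d := fun a =>
      (integral_finsetSum _ fun b _ => hint2 a b).symm
    simp only [this]
    rw [← integral_finsetSum _ fun a _ => integrable_finsetSum _ fun b _ => hint2 a b]
    simp [← Finset.mul_sum, sum_normSq_sphere]
  have hsum := Finset.sum_le_sum fun a (_ : a ∈ Finset.univ) =>
    Finset.sum_le_sum fun b (_ : b ∈ Finset.univ) => hpair a b
  simp only [← Finset.mul_sum, hone, Finset.sum_add_distrib, Finset.sum_const, Finset.card_univ,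
    Fintype.card_fin, nsmul_eq_mul] at hsum
  have hd : (0 : ℝ) < d := by exact_mod_cast Nat.pos_of_ne_zero (NeZero.ne d)
  rw [le_div_iff₀ hd]
  linarith

/-! ### The type matrix -/

/-- The indicator vector of the injective tuples whose set of entries contains `R`. -/
def superTupleVec {d : ℕ} (k : ℕ) (R : Finset (Fin d)) : (Fin k → Fin d) → ℂ :=
  fun i => if Function.Injective i ∧ R ⊆ Finset.univ.image i then 1 else 0

theorem vecMulVec_superTupleVec_apply {d k : ℕ} (R : Finset (Fin d)) (i j : Fin k → Fin d) :
    Matrix.vecMulVec (superTupleVec k R) (star (superTupleVec k R)) i j =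
      if Function.Injective i ∧ Function.Injective j ∧
        R ⊆ Finset.univ.image i ∩ Finset.univ.image j then 1 else 0 := by
  simp only [Matrix.vecMulVec_apply, superTupleVec, Pi.star_apply, Finset.subset_inter_iff]
  split_ifs <;> simp_all

/-- The `0`-`1` matrix recording which pairs of injective tuples have the same set of entries. -/
def typeMatrix (d k : ℕ) : Matrix (Fin k → Fin d) (Fin k → Fin d) ℂ :=
  Matrix.of fun i j => if Function.Injective i ∧ Function.Injective j ∧
    Finset.univ.image i = Finset.univ.image j then 1 else 0

theorem card_image_of_injective_tuple {d k : ℕ} {i : Fin k → Fin d} (hi : Function.Injective i) :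
    (Finset.univ.image i).card = k := by
  rw [Finset.card_image_of_injective _ hi, Finset.card_fin]

/-- The entry sets `I`, `J` of injective tuples have size `k`, so a set `R` of size `k` lies in `I ∩
J` only if `I = J = R`. -/
theorem typeMatrix_eq_sum (d k : ℕ) :
    typeMatrix d k = ∑ R ∈ Finset.powersetCard k (Finset.univ : Finset (Fin d)),
      Matrix.vecMulVec (superTupleVec k R) (star (superTupleVec k R)) := by
  ext i j
  simp only [Matrix.sum_apply, vecMulVec_superTupleVec_apply, typeMatrix, Matrix.of_apply]
  by_cases hi : Function.Injective i
  · by_cases hj : Function.Injective j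
    · simp only [hi, hj, true_and]
      have hci := card_image_of_injective_tuple hi
      have hcj := card_image_of_injective_tuple hj
      have h : ∀ R ∈ Finset.powersetCard k (Finset.univ : Finset (Fin d)),
          (if R ⊆ Finset.univ.image i ∩ Finset.univ.image j then (1 : ℂ) else 0) =
          if R = Finset.univ.image i then
            (if Finset.univ.image i = Finset.univ.image j then 1 else 0) else 0 := by
        intro R hR
        have hcR := (Finset.mem_powersetCard.1 hR).2
        have e1 : R ⊆ Finset.univ.image i ↔ R = Finset.univ.image i :=
          ⟨fun h => Finset.eq_of_subset_of_card_le h (by omega), fun h => h.subset⟩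
        have e2 : R ⊆ Finset.univ.image j ↔ R = Finset.univ.image j :=
          ⟨fun h => Finset.eq_of_subset_of_card_le h (by omega), fun h => h.subset⟩
        simp only [Finset.subset_inter_iff, e1, e2]
        by_cases h : R = Finset.univ.image i
        · simp [← h]
        · simp [h]
      have hm : Finset.univ.image i ∈ Finset.powersetCard k (Finset.univ : Finset (Fin d)) := by
        simpa using hci
      rw [Finset.sum_congr rfl h, Finset.sum_ite_eq', if_pos hm]
    · simp [hj]
  · simp [hi]

theorem posSemidef_typeMatrix (d k : ℕ) : (typeMatrix d k).PosSemidef := by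
  rw [typeMatrix_eq_sum]
  exact Matrix.posSemidef_sum _ fun R _ => Matrix.posSemidef_vecMulVec_self_star _

theorem trace_typeMatrix (d k : ℕ) : (typeMatrix d k).trace = (d.descFactorial k : ℂ) := by
  simp only [Matrix.trace, Matrix.diag, typeMatrix, Matrix.of_apply, and_true, and_self]
  rw [Finset.sum_boole]
  have h := Fintype.card_embedding_eq (α := Fin k) (β := Fin d)
  rw [Fintype.card_fin, Fintype.card_fin,
    ← Fintype.card_congr (Equiv.subtypeInjectiveEquivEmbedding (Fin k) (Fin d)),
    Fintype.card_subtype] at h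
  rw [h]

/-! ### The Haar moment on injective tuples -/

/-- Flipping the sign of the coordinate `i l₀` preserves the measure and negates the integrand,
where that coordinate occurs exactly once. -/
theorem haarMoment_eq_zero_of_notMem {d k : ℕ} {i j : Fin k → Fin d} (hi : Function.Injective i)
    {l₀ : Fin k} (hl : i l₀ ∉ Finset.univ.image j) : haarMoment d k i j = 0 := by
  let f : EuclideanSpace ℂ (Fin d) ≃ₗᵢ[ℂ] EuclideanSpace ℂ (Fin d) :=
    LinearIsometryEquiv.piLpCongrRight 2 fun c =>
      if c = i l₀ then LinearIsometryEquiv.neg ℂ else LinearIsometryEquiv.refl ℂ ℂ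
  have hf : ∀ ψ c, f ψ c = if c = i l₀ then -ψ c else ψ c := by
    intro ψ c
    simp only [f, LinearIsometryEquiv.piLpCongrRight_apply]
    split_ifs <;> simp
  have h := integral_uniformSphere_comp f fun ψ => tensorPow k (ketbra ψ) i j
  have h1 : ∀ ψ, tensorPow k (ketbra (f ψ)) i j = -tensorPow k (ketbra ψ) i j := by
    intro ψ
    have hj : ∀ l, f ψ (j l) = ψ (j l) := fun l => by
      rw [hf, if_neg]
      rintro h
      exact hl (by simp [← h])
    have hi' : ∀ l, f ψ (i l) = (if l = l₀ then -1 else 1) * ψ (i l) := fun l => by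
      rw [hf]
      simp only [hi.eq_iff]
      split_ifs <;> simp
    simp only [tensorPow_ketbra_apply, hj, hi', Finset.prod_mul_distrib, Finset.prod_ite_eq',
      Finset.mem_univ, if_true]
    ring
  simp only [h1, integral_neg] at h
  simp only [haarMoment, Matrix.of_apply]
  exact self_eq_neg.1 h.symm

theorem haarMoment_apply_of_image_eq {d k : ℕ} {i j : Fin k → Fin d} (hi : Function.Injective i)
    (hj : Function.Injective j) (h : Finset.univ.image i = Finset.univ.image j) :
    haarMoment d k i j = haarMoment d k i i := by
  simp only [haarMoment, Matrix.of_apply, tensorPow_ketbra_apply]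
  refine integral_congr_ae (.of_forall fun ψ => ?_)
  simp only
  rw [← Finset.prod_image (s := Finset.univ) (g := i) (f := fun a => star (ψ.1 a)) hi.injOn, h,
    Finset.prod_image hj.injOn]

theorem haarMoment_self_eq {d k : ℕ} {i j : Fin k → Fin d} (hi : Function.Injective i)
    (hj : Function.Injective j) : haarMoment d k i i = haarMoment d k j j := by
  obtain ⟨σ, hσ⟩ := Equiv.Perm.exists_extending_pair i j hi hj
  have h := integral_uniformSphere_comp (LinearIsometryEquiv.piLpCongrLeft 2 ℂ ℂ σ)
    fun ψ => tensorPow k (ketbra ψ) j j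
  simp only [haarMoment, Matrix.of_apply]
  rw [← h]
  refine integral_congr_ae (.of_forall fun ψ => ?_)
  simp only [tensorPow_ketbra_apply, LinearIsometryEquiv.piLpCongrLeft_apply]
  simp [← hσ, Equiv.piCongrLeft']

theorem exists_posSemidef_haarMoment_sub {d k : ℕ} [NeZero d] (hk : k ≤ d) :
    ∃ c : ℝ, (haarMoment d k - (c : ℂ) • typeMatrix d k).PosSemidef ∧
      1 - c * d.descFactorial k ≤ 3 * (k : ℝ) ^ 2 / d := by
  have h₀ : Function.Injective (Fin.castLE hk) := Fin.castLE_injective hk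
  set c : ℝ := ∫ ψ, ∏ l, ‖ψ.1 (Fin.castLE hk l)‖ ^ 2 ∂uniformSphere d with hc
  have hcc : (c : ℂ) = haarMoment d k (Fin.castLE hk) (Fin.castLE hk) := by
    rw [haarMoment_self]
  -- `D` projects onto the non-injective tuples. Compression by `D` keeps positivity, and the trace
  -- of the compression is an expected collision probability.
  let D : Matrix (Fin k → Fin d) (Fin k → Fin d) ℂ :=
    Matrix.diagonal fun i => if Function.Injective i then 0 else 1
  have hnot : ∀ {i j : Fin k → Fin d}, Function.Injective i →
      ¬ (Function.Injective j ∧ Finset.univ.image i = Finset.univ.image j) →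
      haarMoment d k i j = 0 := by
    intro i j hi hij
    by_cases hsub : Finset.univ.image i ⊆ Finset.univ.image j
    · exfalso
      have hci := card_image_of_injective_tuple hi
      have hcj : (Finset.univ.image j).card ≤ k := by
        simpa using Finset.card_image_le (s := Finset.univ) (f := j)
      have heq := Finset.eq_of_subset_of_card_le hsub (by omega)
      have hinj : Set.InjOn j (Finset.univ : Finset (Fin k)) :=
        Finset.card_image_iff.1 (by rw [← heq, hci, Finset.card_fin])
      exact hij ⟨fun a b h => hinj (by simp) (by simp) h, heq⟩
    · simp only [Finset.not_subset, Finset.mem_image, Finset.mem_univ, true_and] at hsub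
      obtain ⟨_, ⟨l, rfl⟩, hl⟩ := hsub
      exact haarMoment_eq_zero_of_notMem hi (by simpa using hl)
  have hdecomp : haarMoment d k - (c : ℂ) • typeMatrix d k = Dᴴ * haarMoment d k * D := by
    ext i j
    simp only [D, Matrix.diagonal_conjTranspose, Matrix.diagonal_mul, Matrix.mul_diagonal,
      Matrix.sub_apply, Matrix.smul_apply, typeMatrix, Matrix.of_apply, smul_eq_mul, Pi.star_apply]
    by_cases hi : Function.Injective i
    · by_cases hij : Function.Injective j ∧ Finset.univ.image i = Finset.univ.image j
      · rw [haarMoment_apply_of_image_eq hi hij.1 hij.2, haarMoment_self_eq hi h₀, ← hcc]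
        simp [hi, hij.1, hij.2]
      · rw [hnot hi hij]
        simp [hi, hij]
    · by_cases hj : Function.Injective j
      · have h := hnot hj (fun h => hi h.1 : ¬ (Function.Injective i ∧
          Finset.univ.image j = Finset.univ.image i))
        rw [← (posSemidef_haarMoment d k).isHermitian.apply i j, h]
        simp [hi]
      · simp [hi, hj]
  refine ⟨c, ?_, ?_⟩
  · rw [hdecomp]
    exact (posSemidef_haarMoment d k).conjTranspose_mul_mul_same D
  · have htr := congrArg Matrix.trace hdecomp
    rw [Matrix.trace_sub, Matrix.trace_smul, trace_haarMoment, trace_typeMatrix] at htr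
    have hR : (Dᴴ * haarMoment d k * D).trace =
        ((∫ ψ, ∑ i : Fin k → Fin d with ¬ Function.Injective i, ∏ l, ‖ψ.1 (i l)‖ ^ 2
          ∂uniformSphere d : ℝ) : ℂ) := by
      rw [integral_finsetSum _ fun i _ => integrable_uniformSphere
        (g := fun ψ => ∏ l, ‖ψ (i l)‖ ^ 2) (by fun_prop), Complex.ofReal_sum, Finset.sum_filter]
      refine Finset.sum_congr rfl fun i _ => ?_
      simp only [D, Matrix.diag, Matrix.diagonal_conjTranspose, Matrix.diagonal_mul,
        Matrix.mul_diagonal, Pi.star_apply, ← haarMoment_self]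
      split_ifs <;> simp_all
    rw [hR, smul_eq_mul] at htr
    have htr' : 1 - c * d.descFactorial k = ∫ ψ, ∑ i : Fin k → Fin d with ¬ Function.Injective i,
        ∏ l, ‖ψ.1 (i l)‖ ^ 2 ∂uniformSphere d := by exact_mod_cast htr
    have hint : ∀ a, Integrable (fun ψ : Metric.sphere (0 : EuclideanSpace ℂ (Fin d)) 1 =>
        ‖ψ.1 a‖ ^ 4) (uniformSphere d) := fun a =>
      integrable_uniformSphere (g := fun ψ => ‖ψ a‖ ^ 4) (by fun_prop)
    rw [htr']
    calc _ ≤ ∫ ψ, (k : ℝ) ^ 2 * ∑ a, ‖ψ.1 a‖ ^ 4 ∂uniformSphere d := by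
          refine integral_mono (integrable_uniformSphere (g := fun ψ =>
            ∑ i : Fin k → Fin d with ¬ Function.Injective i, ∏ l, ‖ψ (i l)‖ ^ 2) (by fun_prop))
            ((integrable_finsetSum _ fun a _ => hint a).const_mul _) fun ψ => ?_
          have := sum_prod_of_not_injective_le (w := fun a => ‖ψ.1 a‖ ^ 2)
            (fun a => by positivity) (sum_normSq_sphere ψ) k
          simpa only [← pow_mul] using this
      _ = (k : ℝ) ^ 2 * ∑ a, ∫ ψ, ‖ψ.1 a‖ ^ 4 ∂uniformSphere d := by
          rw [integral_const_mul, integral_finsetSum _ fun a _ => hint a]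
      _ ≤ (k : ℝ) ^ 2 * (3 / d) :=
          mul_le_mul_of_nonneg_left (sum_integral_norm_pow_four_le d) (by positivity)
      _ = 3 * (k : ℝ) ^ 2 / d := by ring

/-! ### Restricting subset states to injective tuples -/

theorem trace_vecMulVec_self_star {n : Type*} [Fintype n] (u : n → ℂ) :
    (Matrix.vecMulVec u (star u)).trace = ((∑ i, ‖u i‖ ^ 2 : ℝ) : ℂ) := by
  rw [Complex.ofReal_sum]
  refine Finset.sum_congr rfl fun i _ => ?_
  rw [Matrix.diag_apply, Matrix.vecMulVec_apply, Pi.star_apply, Complex.star_def,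
    Complex.mul_conj, Complex.normSq_eq_norm_sq]

/-- A rank-one perturbation estimate, phrased through positive semidefinite matrices. -/
theorem exists_posSemidef_vecMulVec_add_sub {n : Type*} [Fintype n] [DecidableEq n] (u v : n → ℂ)
    {t : ℝ} (ht : 0 < t) (hu : ∑ i, ‖u i‖ ^ 2 ≤ 1) (hv : ∑ i, ‖v i‖ ^ 2 ≤ t ^ 2) :
    ∃ X Y : Matrix n n ℂ, X.PosSemidef ∧ Y.PosSemidef ∧
      Matrix.vecMulVec (u + v) (star (u + v)) - Matrix.vecMulVec u (star u) = X - Y ∧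
      X.trace.re + Y.trace.re ≤ 2 * t + t ^ 2 := by
  -- Polarisation: `uv* + vu* = (2t)⁻¹ (w₊ w₊* - w₋ w₋*)` with `w± = tu ± v`. The weight `t`
  -- balances the norms of the two summands, so the two traces add up to at most `2t`; the term
  -- `vv*` adds `t²`.
  let w : ℂ → n → ℂ := fun z => (t : ℂ) • u + z • v
  have hpos : ∀ z, (((2 * t)⁻¹ : ℝ) • Matrix.vecMulVec (w z) (star (w z))).PosSemidef := fun z =>
    (Matrix.posSemidef_vecMulVec_self_star _).smul (by positivity)
  refine ⟨((2 * t)⁻¹ : ℝ) • Matrix.vecMulVec (w 1) (star (w 1)) + Matrix.vecMulVec v (star v),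
    ((2 * t)⁻¹ : ℝ) • Matrix.vecMulVec (w (-1)) (star (w (-1))),
    (hpos 1).add (Matrix.posSemidef_vecMulVec_self_star _), hpos _, ?_, ?_⟩
  · ext i j
    have ht' : (t : ℂ) ≠ 0 := by exact_mod_cast ht.ne'
    simp only [w, Matrix.sub_apply, Matrix.add_apply, Matrix.smul_apply, Matrix.vecMulVec_apply,
      Pi.star_apply, Pi.add_apply, Pi.smul_apply, smul_eq_mul, star_add, star_mul', star_neg,
      star_one, Complex.real_smul, Complex.star_def, Complex.conj_ofReal, Complex.ofReal_inv,
      Complex.ofReal_mul, Complex.ofReal_ofNat]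
    field_simp
    ring
  · simp only [Matrix.trace_add, Matrix.trace_smul, trace_vecMulVec_self_star, Complex.add_re,
      Complex.real_smul, ← Complex.ofReal_mul, Complex.ofReal_re]
    have hw : ∑ i, ‖w 1 i‖ ^ 2 + ∑ i, ‖w (-1) i‖ ^ 2 =
        2 * (t ^ 2 * ∑ i, ‖u i‖ ^ 2 + ∑ i, ‖v i‖ ^ 2) := by
      rw [← Finset.sum_add_distrib, Finset.mul_sum, ← Finset.sum_add_distrib, Finset.mul_sum]
      refine Finset.sum_congr rfl fun i _ => ?_
      have h := parallelogram_law_with_norm ℝ ((t : ℂ) * u i) (v i)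
      simp only [w, Pi.add_apply, Pi.smul_apply, smul_eq_mul, one_mul, neg_mul, ← sub_eq_add_neg]
      rw [norm_mul, Complex.norm_real, Real.norm_of_nonneg ht.le] at h
      linarith
    have h1 : (2 * t)⁻¹ * ∑ i, ‖w 1 i‖ ^ 2 + (2 * t)⁻¹ * ∑ i, ‖w (-1) i‖ ^ 2 ≤ 2 * t := by
      rw [← mul_add, hw, inv_mul_le_iff₀ (by positivity)]
      nlinarith [mul_le_mul_of_nonneg_left hu (sq_nonneg t)]
    linarith

theorem subsetKet_apply {d : ℕ} (S : Finset (Fin d)) (a : Fin d) :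
    subsetKet S a = if a ∈ S then ((1 / √(S.card : ℝ) : ℝ) : ℂ) else 0 := by
  simp only [subsetKet, PiLp.smul_apply, smul_eq_mul, WithLp.ofLp_sum, Finset.sum_apply,
    PiLp.single_apply]
  simp

theorem norm_sq_subsetKet {d : ℕ} (S : Finset (Fin d)) (a : Fin d) :
    ‖subsetKet S a‖ ^ 2 = if a ∈ S then (S.card : ℝ)⁻¹ else 0 := by
  rw [subsetKet_apply]
  split_ifs
  · rw [Complex.norm_real, Real.norm_of_nonneg (by positivity), div_pow,
      Real.sq_sqrt (Nat.cast_nonneg _), one_pow, one_div]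
  · simp

theorem sum_norm_sq_subsetKet {d : ℕ} {S : Finset (Fin d)} (hS : S.Nonempty) :
    ∑ a, ‖subsetKet S a‖ ^ 2 = 1 := by
  simp only [norm_sq_subsetKet, Finset.sum_ite_mem, Finset.univ_inter, Finset.sum_const,
    nsmul_eq_mul]
  exact mul_inv_cancel₀ (by exact_mod_cast hS.card_pos.ne')

theorem sum_norm_sq_sq_subsetKet {d : ℕ} {S : Finset (Fin d)} (hS : S.Nonempty) :
    ∑ a, (‖subsetKet S a‖ ^ 2) ^ 2 = (S.card : ℝ)⁻¹ := by
  have hc : (S.card : ℝ) ≠ 0 := by exact_mod_cast hS.card_pos.ne'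
  simp only [norm_sq_subsetKet, ite_pow, ne_eq, OfNat.ofNat_ne_zero, not_false_eq_true, zero_pow,
    Finset.sum_ite_mem, Finset.univ_inter, Finset.sum_const, nsmul_eq_mul]
  field_simp

/-- The component of `ψ^{⊗k}` supported on the injective tuples. -/
def injectivePart {d : ℕ} (k : ℕ) (ψ : EuclideanSpace ℂ (Fin d)) : (Fin k → Fin d) → ℂ :=
  fun i => if Function.Injective i then tensorKet k ψ i else 0

theorem sum_norm_sq_tensorKet {d k : ℕ} {ψ : EuclideanSpace ℂ (Fin d)}
    (hψ : ∑ a, ‖ψ a‖ ^ 2 = 1) : ∑ i, ‖tensorKet k ψ i‖ ^ 2 = 1 := by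
  have h := trace_tensorPow_ketbra (k := k) hψ
  rw [tensorPow_ketbra, trace_vecMulVec_self_star] at h
  exact_mod_cast h

theorem sum_norm_sq_injectivePart_le {d k : ℕ} {ψ : EuclideanSpace ℂ (Fin d)}
    (hψ : ∑ a, ‖ψ a‖ ^ 2 = 1) : ∑ i, ‖injectivePart k ψ i‖ ^ 2 ≤ 1 := by
  rw [← sum_norm_sq_tensorKet (k := k) hψ]
  refine Finset.sum_le_sum fun i _ => ?_
  unfold injectivePart
  split_ifs
  · rfl
  · simp

theorem sum_norm_sq_tensorKet_sub_injectivePart_le {d k : ℕ} {S : Finset (Fin d)}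
    (hS : S.Nonempty) :
    ∑ i, ‖(tensorKet k (subsetKet S) - injectivePart k (subsetKet S)) i‖ ^ 2 ≤
      (k : ℝ) ^ 2 / S.card := by
  have h := sum_prod_of_not_injective_le (w := fun a => ‖subsetKet S a‖ ^ 2)
    (fun a => by positivity) (sum_norm_sq_subsetKet hS) k
  rw [sum_norm_sq_sq_subsetKet hS, ← div_eq_mul_inv, Finset.sum_filter] at h
  refine le_trans (le_of_eq (Finset.sum_congr rfl fun i _ => ?_)) h
  simp only [Pi.sub_apply, injectivePart, tensorKet]
  split_ifs
  · simp
  · rw [sub_zero, norm_prod, Finset.prod_pow]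

theorem one_sub_le_sum_norm_sq_injectivePart {d k : ℕ} {S : Finset (Fin d)} (hS : S.Nonempty) :
    1 - (k : ℝ) ^ 2 / S.card ≤ ∑ i, ‖injectivePart k (subsetKet S) i‖ ^ 2 := by
  have h := sum_norm_sq_tensorKet_sub_injectivePart_le (k := k) hS
  have h1 := sum_norm_sq_tensorKet (k := k) (sum_norm_sq_subsetKet hS)
  have h2 : ∑ i, ‖tensorKet k (subsetKet S) i‖ ^ 2 = ∑ i, ‖injectivePart k (subsetKet S) i‖ ^ 2 +
      ∑ i, ‖(tensorKet k (subsetKet S) - injectivePart k (subsetKet S)) i‖ ^ 2 := by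
    rw [← Finset.sum_add_distrib]
    refine Finset.sum_congr rfl fun i _ => ?_
    simp only [Pi.sub_apply, injectivePart]
    split_ifs <;> simp
  linarith

theorem exists_posSemidef_tensorPow_subsetKet_sub {d k : ℕ} {S : Finset (Fin d)}
    (hS : S.Nonempty) (hk : k ^ 2 ≤ S.card) :
    ∃ X Y : Matrix (Fin k → Fin d) (Fin k → Fin d) ℂ, X.PosSemidef ∧ Y.PosSemidef ∧
      tensorPow k (ketbra (subsetKet S)) - Matrix.vecMulVec (injectivePart k (subsetKet S))
        (star (injectivePart k (subsetKet S))) = X - Y ∧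
      X.trace.re + Y.trace.re ≤ 3 * (k / √(S.card : ℝ)) := by
  -- The perturbation estimate needs `t = k / √|S|` positive; for `k = 0` every tuple is injective
  -- and nothing is cut off.
  rcases Nat.eq_zero_or_pos k with rfl | hk0
  · refine ⟨0, 0, Matrix.PosSemidef.zero, Matrix.PosSemidef.zero, ?_, by simp⟩
    have : injectivePart 0 (subsetKet S) = tensorKet 0 (subsetKet S) := by
      ext i
      simp [injectivePart, Function.injective_of_subsingleton]
    rw [tensorPow_ketbra, this]
    simp
  · have hc : (0 : ℝ) < S.card := by exact_mod_cast hS.card_pos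
    have hs : 0 < √(S.card : ℝ) := Real.sqrt_pos.2 hc
    have hk0' : (0 : ℝ) < k := by exact_mod_cast hk0
    have ht2 : (k / √(S.card : ℝ)) ^ 2 = (k : ℝ) ^ 2 / S.card := by
      rw [div_pow, Real.sq_sqrt hc.le]
    have ht1 : k / √(S.card : ℝ) ≤ 1 := by
      rw [← sq_le_one_iff₀ (by positivity), ht2, div_le_one hc]
      exact_mod_cast hk
    have ht : 0 < k / √(S.card : ℝ) := by positivity
    obtain ⟨X, Y, hX, hY, hXY, htr⟩ := exists_posSemidef_vecMulVec_add_sub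
      (injectivePart k (subsetKet S)) (tensorKet k (subsetKet S) - injectivePart k (subsetKet S))
      ht (sum_norm_sq_injectivePart_le (sum_norm_sq_subsetKet hS))
      (by rw [ht2]; exact sum_norm_sq_tensorKet_sub_injectivePart_le hS)
    refine ⟨X, Y, hX, hY, ?_, htr.trans ?_⟩
    · rw [← hXY, tensorPow_ketbra, add_sub_cancel]
    · nlinarith

/-! ### Binomial identities and estimates -/

/-- Vandermonde's identity, with the selections sorted by their part `R` in `A`. The guard matters:
without it, truncated subtraction would contribute `m.choose 0 = 1`. -/
theorem Nat.add_card_choose_eq_sum_powerset {α : Type*} (m n : ℕ) (A : Finset α) :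
    (m + A.card).choose n =
      ∑ R ∈ A.powerset, if R.card ≤ n then m.choose (n - R.card) else 0 := by
  rw [Finset.sum_powerset_apply_card (fun r => if r ≤ n then m.choose (n - r) else 0),
    Nat.add_comm, Nat.add_choose_eq, Finset.Nat.sum_antidiagonal_eq_sum_range_succ_mk]
  simp only [smul_eq_mul, mul_ite, mul_zero]
  rw [← Finset.sum_filter]
  have hN : ∀ N, n ≤ N → ∑ r ∈ Finset.range n.succ, A.card.choose r * m.choose (n - r) =
      ∑ r ∈ Finset.range (N + 1) with r ≤ n, A.card.choose r * m.choose (n - r) := by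
    intro N hN
    refine Finset.sum_congr ?_ fun _ _ => rfl
    ext r
    simp only [Finset.mem_range, Finset.mem_filter]
    omega
  rw [hN (max n A.card) (le_max_left _ _)]
  symm
  refine Finset.sum_subset (fun r => ?_) fun r hr hr' => ?_
  · simp only [Finset.mem_range, Finset.mem_filter]
    omega
  · simp only [Finset.mem_range, Finset.mem_filter] at hr hr'
    rw [Nat.choose_eq_zero_of_lt (by omega), zero_mul]

/-- Counting complements leaves `A` only in the upper index of the binomial coefficient, as
Vandermonde's identity requires. -/
theorem card_powersetCard_filter_superset {d s : ℕ} (hs : s ≤ d) (A : Finset (Fin d)) :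
    ((Finset.powersetCard s (Finset.univ : Finset (Fin d))).filter (A ⊆ ·)).card =
      (d - A.card).choose (d - s) := by
  have h : (Finset.powersetCard (d - s) Aᶜ).card = (d - A.card).choose (d - s) := by
    rw [Finset.card_powersetCard, Finset.card_compl, Fintype.card_fin]
  rw [← h]
  refine Finset.card_bij' (fun S _ => Sᶜ) (fun S _ => Sᶜ) ?_ ?_ (by simp) (by simp)
  · intro S hS
    simp only [Finset.mem_filter, Finset.mem_powersetCard, Finset.subset_univ, true_and] at hS
    rw [Finset.mem_powersetCard, Finset.card_compl, Fintype.card_fin, hS.1]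
    exact ⟨Finset.compl_subset_compl.2 hS.2, rfl⟩
  · intro S hS
    rw [Finset.mem_powersetCard] at hS
    simp only [Finset.mem_filter, Finset.mem_powersetCard, Finset.subset_univ, true_and]
    rw [Finset.card_compl, Fintype.card_fin, hS.2]
    exact ⟨by omega, Finset.subset_compl_comm.1 hS.1⟩

/-- Lowering both indices by one multiplies the coefficient by `1 - (a - b) / (a + k + 1) ≥ 1 - e`;
over `k` steps the losses add, as in Bernoulli's inequality. -/
theorem choose_add_sub_le {a b : ℕ} (hab : b ≤ a) {e : ℝ} (he : ((a - b : ℕ) : ℝ) ≤ e * (a + 1))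
    (k : ℕ) :
    ((a + k).choose (b + k) : ℝ) - k * e * (a + k).choose (b + k) ≤ a.choose b := by
  have he0 : 0 ≤ e := by
    by_contra h
    have : e * (a + 1) < 0 := mul_neg_of_neg_of_pos (not_le.1 h) (by positivity)
    linarith [Nat.cast_nonneg (α := ℝ) (a - b)]
  induction k with
  | zero => simp
  | succ k ih =>
    have h1 : ((a + k + 1 : ℕ) : ℝ) * (a + k).choose (b + k) =
        (a + k + 1).choose (b + k + 1) * ((b + k + 1 : ℕ) : ℝ) := by
      exact_mod_cast Nat.add_one_mul_choose_eq (a + k) (b + k)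
    rw [← add_assoc, ← add_assoc]
    set c : ℝ := (((a + k).choose (b + k) : ℕ) : ℝ)
    set c' : ℝ := (((a + k + 1).choose (b + k + 1) : ℕ) : ℝ)
    have hc' : 0 ≤ c' := Nat.cast_nonneg _
    push_cast [Nat.cast_sub hab] at h1 he ⊢
    have hk : (0 : ℝ) ≤ k := Nat.cast_nonneg _
    have hA : (0 : ℝ) < a + k + 1 := by positivity
    have hab' : (b : ℝ) ≤ a := by exact_mod_cast hab
    have hcc : c ≤ c' := by
      refine le_of_mul_le_mul_left ?_ hA
      rw [h1]
      nlinarith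
    have hstep : c' - e * c' ≤ c := by
      refine le_of_mul_le_mul_left ?_ hA
      rw [h1]
      nlinarith [mul_le_mul_of_nonneg_left he hc', mul_nonneg (mul_nonneg hk he0) hc']
    nlinarith [mul_le_mul_of_nonneg_left hcc (mul_nonneg hk he0)]

theorem tensorKet_subsetKet_apply {d k : ℕ} (S : Finset (Fin d)) (i : Fin k → Fin d) :
    tensorKet k (subsetKet S) i =
      if Finset.univ.image i ⊆ S then ((1 / √(S.card : ℝ) : ℝ) : ℂ) ^ k else 0 := by
  simp only [tensorKet, subsetKet_apply, Finset.prod_ite_zero, Finset.image_subset_iff]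
  simp

theorem vecMulVec_injectivePart_apply {d k : ℕ} (S : Finset (Fin d)) (i j : Fin k → Fin d) :
    Matrix.vecMulVec (injectivePart k (subsetKet S)) (star (injectivePart k (subsetKet S))) i j =
      if Function.Injective i ∧ Function.Injective j ∧
        Finset.univ.image i ∪ Finset.univ.image j ⊆ S then ((S.card : ℂ) ^ k)⁻¹ else 0 := by
  have h : ((1 / √(S.card : ℝ) : ℝ) : ℂ) ^ k * ((1 / √(S.card : ℝ) : ℝ) : ℂ) ^ k =
      ((S.card : ℂ) ^ k)⁻¹ := by
    rw [← mul_pow, ← Complex.ofReal_mul, one_div, ← mul_inv,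
      Real.mul_self_sqrt (Nat.cast_nonneg _)]
    simp
  simp only [Matrix.vecMulVec_apply, Pi.star_apply, injectivePart, tensorKet_subsetKet_apply,
    Finset.union_subset_iff]
  split_ifs <;> simp_all

/-! ### The truncated subset moment dominates a multiple of the type matrix -/

/-- The average of `φ_S^{⊗k}` with each `φ_S^{⊗k}` truncated to the injective tuples. -/
noncomputable def injectiveSubsetMoment (d s k : ℕ) : Matrix (Fin k → Fin d) (Fin k → Fin d) ℂ :=
  ((Finset.powersetCard s (Finset.univ : Finset (Fin d))).card : ℂ)⁻¹ •
    ∑ S ∈ Finset.powersetCard s (Finset.univ : Finset (Fin d)),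
      Matrix.vecMulVec (injectivePart k (subsetKet S)) (star (injectivePart k (subsetKet S)))

theorem injectiveSubsetMoment_apply {d s k : ℕ} (hs : s ≤ d) (i j : Fin k → Fin d) :
    injectiveSubsetMoment d s k i j = if Function.Injective i ∧ Function.Injective j then
      ((d.choose s : ℂ) * (s : ℂ) ^ k)⁻¹ *
        (d - (Finset.univ.image i ∪ Finset.univ.image j).card).choose (d - s) else 0 := by
  rw [injectiveSubsetMoment, Matrix.smul_apply, Matrix.sum_apply, Finset.card_powersetCard,
    Finset.card_univ, Fintype.card_fin]
  have h : ∀ S ∈ Finset.powersetCard s (Finset.univ : Finset (Fin d)),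
      Matrix.vecMulVec (injectivePart k (subsetKet S)) (star (injectivePart k (subsetKet S))) i j =
      if Function.Injective i ∧ Function.Injective j then
        (if Finset.univ.image i ∪ Finset.univ.image j ⊆ S then ((s : ℂ) ^ k)⁻¹ else 0) else 0 := by
    intro S hS
    rw [vecMulVec_injectivePart_apply, (Finset.mem_powersetCard.1 hS).2]
    by_cases h : Function.Injective i ∧ Function.Injective j <;> simp [← and_assoc, h]
  rw [Finset.sum_congr rfl h]
  by_cases hij : Function.Injective i ∧ Function.Injective j
  · simp only [if_pos hij]
    rw [← Finset.sum_filter, Finset.sum_const, card_powersetCard_filter_superset hs, nsmul_eq_mul,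
      smul_eq_mul, mul_inv]
    ring
  · simp [hij]

/-- Since `|I ∪ J| = 2k - |I ∩ J|`, the count of sets `S ⊇ I ∪ J` is a binomial coefficient with
upper index `d - 2k + |I ∩ J|`, to which Vandermonde's identity applies. -/
theorem injectiveSubsetMoment_eq_sum {d s k : ℕ} (hs : s ≤ d) (hk : 2 * k ≤ d) :
    injectiveSubsetMoment d s k = ∑ R : Finset (Fin d),
      ((((d.choose s : ℝ) * (s : ℝ) ^ k)⁻¹ *
        (if R.card ≤ d - s then (d - 2 * k).choose (d - s - R.card) else 0 : ℕ) : ℝ) •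
        Matrix.vecMulVec (superTupleVec k R) (star (superTupleVec k R))) := by
  ext i j
  rw [injectiveSubsetMoment_apply hs, Matrix.sum_apply]
  simp only [Matrix.smul_apply, vecMulVec_superTupleVec_apply]
  by_cases hij : Function.Injective i ∧ Function.Injective j
  · have hci := card_image_of_injective_tuple hij.1
    have hcj := card_image_of_injective_tuple hij.2
    have hu := Finset.card_union_add_card_inter (Finset.univ.image i) (Finset.univ.image j)
    have hle := Finset.card_le_card
      (Finset.inter_subset_left (s₁ := Finset.univ.image i) (s₂ := Finset.univ.image j))
    rw [if_pos hij, show d - (Finset.univ.image i ∪ Finset.univ.image j).card =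
      d - 2 * k + (Finset.univ.image i ∩ Finset.univ.image j).card by omega,
      Nat.add_card_choose_eq_sum_powerset, Nat.cast_sum, Finset.mul_sum]
    simp only [hij.1, hij.2, true_and, smul_ite, smul_zero]
    rw [← Finset.sum_filter]
    refine Finset.sum_congr ?_ fun R _ => ?_
    · ext R
      simp only [Finset.mem_powerset, Finset.mem_filter, Finset.mem_univ, true_and]
    · rw [Complex.real_smul]
      split_ifs <;> push_cast <;> ring
  · rw [if_neg hij]
    refine (Finset.sum_eq_zero fun R _ => ?_).symm
    have h : ¬ (Function.Injective i ∧ Function.Injective j ∧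
        R ⊆ Finset.univ.image i ∩ Finset.univ.image j) := fun h => hij ⟨h.1, h.2.1⟩
    rw [if_neg h, smul_zero]

/-- The subtracted matrix is the part `|R| = k` of a sum of positive terms. -/
theorem posSemidef_injectiveSubsetMoment_sub {d s k : ℕ} (hs : s ≤ d) (hk : 2 * k ≤ d)
    (hsk : k + s ≤ d) :
    (injectiveSubsetMoment d s k - ((((d.choose s : ℝ) * (s : ℝ) ^ k)⁻¹ *
      (d - 2 * k).choose (d - s - k) : ℝ) : ℂ) • typeMatrix d k).PosSemidef := by
  have hpos : ∀ R : Finset (Fin d), ((((d.choose s : ℝ) * (s : ℝ) ^ k)⁻¹ *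
        (if R.card ≤ d - s then (d - 2 * k).choose (d - s - R.card) else 0 : ℕ) : ℝ) •
        Matrix.vecMulVec (superTupleVec k R) (star (superTupleVec k R))).PosSemidef := fun R =>
    (Matrix.posSemidef_vecMulVec_self_star _).smul (by positivity)
  have h : ((((d.choose s : ℝ) * (s : ℝ) ^ k)⁻¹ * (d - 2 * k).choose (d - s - k) : ℝ) : ℂ) •
      typeMatrix d k = ∑ R ∈ Finset.powersetCard k (Finset.univ : Finset (Fin d)),
      ((((d.choose s : ℝ) * (s : ℝ) ^ k)⁻¹ *
        (if R.card ≤ d - s then (d - 2 * k).choose (d - s - R.card) else 0 : ℕ) : ℝ) •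
        Matrix.vecMulVec (superTupleVec k R) (star (superTupleVec k R))) := by
    rw [typeMatrix_eq_sum, Finset.smul_sum]
    refine Finset.sum_congr rfl fun R hR => ?_
    rw [(Finset.mem_powersetCard.1 hR).2, if_pos (by omega : k ≤ d - s), Complex.coe_smul]
  rw [h, injectiveSubsetMoment_eq_sum hs hk, sub_eq_iff_eq_add.2
    (Finset.sum_sdiff (Finset.subset_univ _)).symm]
  exact Matrix.posSemidef_sum _ fun R _ => hpos R

theorem trace_injectiveSubsetMoment {d s k : ℕ} (hs : s ≤ d) :
    (injectiveSubsetMoment d s k).trace = ((((d.choose s : ℝ) * (s : ℝ) ^ k)⁻¹ *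
      (d - k).choose (d - s) * d.descFactorial k : ℝ) : ℂ) := by
  have h : ∀ i : Fin k → Fin d, injectiveSubsetMoment d s k i i =
      (((d.choose s : ℂ) * (s : ℂ) ^ k)⁻¹ * (d - k).choose (d - s)) * typeMatrix d k i i := by
    intro i
    rw [injectiveSubsetMoment_apply hs]
    simp only [typeMatrix, Matrix.of_apply, and_self, and_true, Finset.union_self]
    split_ifs with hi
    · rw [card_image_of_injective_tuple hi, mul_one]
    · simp
  simp only [Matrix.trace, Matrix.diag, h]
  rw [← Finset.mul_sum]
  have := trace_typeMatrix d k
  simp only [Matrix.trace, Matrix.diag] at this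
  rw [this]
  push_cast
  rfl

theorem trace_injectiveSubsetMoment_re_mem {d s k : ℕ} (hs1 : 1 ≤ s) (hs : s ≤ d) :
    1 - (k : ℝ) ^ 2 / s ≤ (injectiveSubsetMoment d s k).trace.re ∧
      (injectiveSubsetMoment d s k).trace.re ≤ 1 := by
  have hN : (0 : ℝ) < ((Finset.powersetCard s (Finset.univ : Finset (Fin d))).card : ℝ) := by
    rw [Finset.card_powersetCard, Finset.card_univ, Fintype.card_fin]
    exact_mod_cast Nat.choose_pos hs
  have hS : ∀ S ∈ Finset.powersetCard s (Finset.univ : Finset (Fin d)), S.Nonempty ∧ S.card = s :=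
    fun S hS => ⟨Finset.card_pos.1 (by rw [(Finset.mem_powersetCard.1 hS).2]; omega),
      (Finset.mem_powersetCard.1 hS).2⟩
  have h : (injectiveSubsetMoment d s k).trace.re =
      ((Finset.powersetCard s (Finset.univ : Finset (Fin d))).card : ℝ)⁻¹ *
        ∑ S ∈ Finset.powersetCard s (Finset.univ : Finset (Fin d)),
          ∑ i, ‖injectivePart k (subsetKet S) i‖ ^ 2 := by
    rw [injectiveSubsetMoment, Matrix.trace_smul, Matrix.trace_sum]
    simp only [trace_vecMulVec_self_star]
    rw [← Complex.ofReal_sum, smul_eq_mul, ← Complex.ofReal_natCast, ← Complex.ofReal_inv,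
      ← Complex.ofReal_mul, Complex.ofReal_re]
  rw [h, inv_mul_le_iff₀ hN, le_inv_mul_iff₀ hN]
  constructor
  · rw [← nsmul_eq_mul]
    refine Finset.card_nsmul_le_sum _ _ _ fun S h' => ?_
    have := one_sub_le_sum_norm_sq_injectivePart (k := k) (hS S h').1
    rwa [(hS S h').2] at this
  · rw [← nsmul_eq_mul]
    exact Finset.sum_le_card_nsmul _ _ _ fun S h' =>
      sum_norm_sq_injectivePart_le (sum_norm_sq_subsetKet (hS S h').1)

theorem one_sub_trace_smul_typeMatrix_le {d s k : ℕ} (hs1 : 1 ≤ s) (hs : s ≤ d) (hk : 4 * k ≤ d)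
    (hks : k ≤ s) (hsk : k + s ≤ d) :
    1 - (((d.choose s : ℝ) * (s : ℝ) ^ k)⁻¹ * (d - 2 * k).choose (d - s - k)) *
      d.descFactorial k ≤ (k : ℝ) ^ 2 / s + 2 * (s * k / d) := by
  have hd : (0 : ℝ) < d := by exact_mod_cast (by omega : 0 < d)
  obtain ⟨h1, h2⟩ := trace_injectiveSubsetMoment_re_mem (k := k) hs1 hs
  -- The traces of `l • G` and `P` differ by the factor `C(d-2k, d-s-k) / C(d-k, d-s)`. The choice
  -- `e = 2s/d` is allowed because `4k ≤ d` gives `d - 2k ≥ d/2`.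
  rw [trace_injectiveSubsetMoment hs, Complex.ofReal_re] at h1 h2
  have hch := choose_add_sub_le (a := d - 2 * k) (b := d - s - k) (by omega) (e := 2 * s / d) (by
    have h3 : ((d - 2 * k - (d - s - k) : ℕ) : ℝ) ≤ s := by exact_mod_cast (by omega)
    refine h3.trans ?_
    rw [Nat.cast_sub (by omega), div_mul_eq_mul_div, le_div_iff₀ hd]
    have h4 : (4 * k : ℝ) ≤ d := by exact_mod_cast hk
    have h5 : (0 : ℝ) ≤ s := Nat.cast_nonneg _
    push_cast
    nlinarith) k
  rw [show d - 2 * k + k = d - k by omega, show d - s - k + k = d - s by omega] at hch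
  have hw : (0 : ℝ) ≤ ((d.choose s : ℝ) * (s : ℝ) ^ k)⁻¹ * d.descFactorial k := by positivity
  have := mul_le_mul_of_nonneg_left hch hw
  have h6 : (0 : ℝ) ≤ k * (2 * s / d) := by positivity
  have h7 := mul_le_mul_of_nonneg_left h2 h6
  have h8 : (k : ℝ) * (2 * s / d) = 2 * (s * k / d) := by ring
  rw [h8] at h7
  have h9 : ((d.choose s : ℝ) * (s : ℝ) ^ k)⁻¹ * d.descFactorial k *
      (((d - k).choose (d - s) : ℝ) - k * (2 * s / d) * (d - k).choose (d - s)) =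
      ((d.choose s : ℝ) * (s : ℝ) ^ k)⁻¹ * (d - k).choose (d - s) * d.descFactorial k -
      2 * (s * k / d) * (((d.choose s : ℝ) * (s : ℝ) ^ k)⁻¹ * (d - k).choose (d - s) *
        d.descFactorial k) := by
    rw [h8]; ring
  rw [h9] at this
  linarith

/-! ### Comparison of the two moments -/

theorem exists_posSemidef_subsetMoment_sub {d s k : ℕ} (hs1 : 1 ≤ s) (hs : s ≤ d)
    (hk : k ^ 2 ≤ s) :
    ∃ X Y : Matrix (Fin k → Fin d) (Fin k → Fin d) ℂ, X.PosSemidef ∧ Y.PosSemidef ∧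
      subsetMoment d s k - injectiveSubsetMoment d s k = X - Y ∧
      X.trace.re + Y.trace.re ≤ 3 * (k / √(s : ℝ)) := by
  set F := Finset.powersetCard s (Finset.univ : Finset (Fin d)) with hF
  have hN : (0 : ℝ) < (F.card : ℝ) := by
    rw [hF, Finset.card_powersetCard, Finset.card_univ, Fintype.card_fin]
    exact_mod_cast Nat.choose_pos hs
  have hcard : ∀ S ∈ F, S.card = s := fun S h => (Finset.mem_powersetCard.1 h).2
  have hex : ∀ S : Finset (Fin d), ∃ X Y : Matrix (Fin k → Fin d) (Fin k → Fin d) ℂ, S ∈ F →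
      X.PosSemidef ∧ Y.PosSemidef ∧
      tensorPow k (ketbra (subsetKet S)) - Matrix.vecMulVec (injectivePart k (subsetKet S))
        (star (injectivePart k (subsetKet S))) = X - Y ∧
      X.trace.re + Y.trace.re ≤ 3 * (k / √(s : ℝ)) := by
    intro S
    by_cases h : S ∈ F
    · have hc := hcard S h
      obtain ⟨X, Y, hXY⟩ := exists_posSemidef_tensorPow_subsetKet_sub (k := k) (S := S)
        (Finset.card_pos.1 (by omega)) (by omega)
      rw [hc] at hXY
      exact ⟨X, Y, fun _ => hXY⟩
    · exact ⟨0, 0, fun h' => absurd h' h⟩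
  choose X Y hXY using hex
  refine ⟨(F.card : ℝ)⁻¹ • ∑ S ∈ F, X S, (F.card : ℝ)⁻¹ • ∑ S ∈ F, Y S,
    (Matrix.posSemidef_sum _ fun S h => (hXY S h).1).smul (by positivity),
    (Matrix.posSemidef_sum _ fun S h => (hXY S h).2.1).smul (by positivity), ?_, ?_⟩
  · rw [subsetMoment, injectiveSubsetMoment, ← smul_sub, ← smul_sub, ← Finset.sum_sub_distrib,
      ← Finset.sum_sub_distrib, Finset.sum_congr rfl fun S h => (hXY S h).2.2.1,
      ← Complex.coe_smul]
    simp [hF]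
  · simp only [Matrix.trace_smul, Matrix.trace_sum, Complex.smul_re, Complex.re_sum, smul_eq_mul]
    rw [← mul_add, ← Finset.sum_add_distrib, inv_mul_le_iff₀ hN, ← nsmul_eq_mul]
    exact Finset.sum_le_card_nsmul _ _ _ fun S h => (hXY S h).2.2.2

theorem posSemidef_subsetMoment (d s k : ℕ) : (subsetMoment d s k).PosSemidef := by
  have h : subsetMoment d s k =
      ((Finset.powersetCard s (Finset.univ : Finset (Fin d))).card : ℝ)⁻¹ •
      ∑ S ∈ Finset.powersetCard s (Finset.univ : Finset (Fin d)),
        tensorPow k (ketbra (subsetKet S)) := by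
    rw [subsetMoment, ← Complex.coe_smul]
    simp
  rw [h]
  exact (Matrix.posSemidef_sum _ fun S _ => posSemidef_tensorPow_ketbra _).smul (by positivity)

theorem trace_subsetMoment {d s : ℕ} (k : ℕ) (hs1 : 1 ≤ s) (hs : s ≤ d) :
    (subsetMoment d s k).trace = 1 := by
  have hN : ((Finset.powersetCard s (Finset.univ : Finset (Fin d))).card : ℂ) ≠ 0 := by
    rw [Finset.card_powersetCard, Finset.card_univ, Fintype.card_fin]
    exact_mod_cast (Nat.choose_pos hs).ne'
  have h : ∀ S ∈ Finset.powersetCard s (Finset.univ : Finset (Fin d)),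
      (tensorPow k (ketbra (subsetKet S))).trace = 1 := fun S hS =>
    trace_tensorPow_ketbra (sum_norm_sq_subsetKet
      (Finset.card_pos.1 (by rw [(Finset.mem_powersetCard.1 hS).2]; omega)))
  rw [subsetMoment, Matrix.trace_smul, Matrix.trace_sum, Finset.sum_congr rfl h, Finset.sum_const,
    nsmul_eq_mul, mul_one, smul_eq_mul, inv_mul_cancel₀ hN]

theorem traceNorm_haarMoment_sub_subsetMoment_le_two {d s : ℕ} (k : ℕ) (hs1 : 1 ≤ s) (hs : s ≤ d) :
    traceNorm (haarMoment d k - subsetMoment d s k) ≤ 2 := by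
  have : NeZero d := ⟨by omega⟩
  refine (traceNorm_sub_le (posSemidef_haarMoment d k) (posSemidef_subsetMoment d s k)).trans ?_
  rw [trace_haarMoment, trace_subsetMoment k hs1 hs]
  norm_num

theorem traceNorm_haarMoment_sub_subsetMoment_le {d s k : ℕ} (hs1 : 1 ≤ s) (hs : s ≤ d)
    (hk : 4 * k ≤ d) (hks : k ^ 2 ≤ s) (hsk : k + s ≤ d) :
    traceNorm (haarMoment d k - subsetMoment d s k) ≤
      6 * ((k : ℝ) ^ 2 / d) + 3 * (k / √(s : ℝ)) + 2 * ((k : ℝ) ^ 2 / s) + 4 * (s * k / d) := by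
  have : NeZero d := ⟨by omega⟩
  have hks' : k ≤ s := (Nat.le_self_pow two_ne_zero k).trans hks
  obtain ⟨c, hHc, hc⟩ := exists_posSemidef_haarMoment_sub (d := d) (k := k) (by omega)
  obtain ⟨X, Y, hX, hY, hXY, htr⟩ := exists_posSemidef_subsetMoment_sub hs1 hs hks
  have hPl := posSemidef_injectiveSubsetMoment_sub hs (by omega : 2 * k ≤ d) hsk
  have hl := one_sub_trace_smul_typeMatrix_le hs1 hs hk hks' hsk
  set l : ℝ := ((d.choose s : ℝ) * (s : ℝ) ^ k)⁻¹ * (d - 2 * k).choose (d - s - k)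
  have hG : ∀ x : ℝ, ((x : ℂ) • typeMatrix d k).trace.re = x * d.descFactorial k := fun x => by
    rw [Matrix.trace_smul, trace_typeMatrix, smul_eq_mul, ← Complex.ofReal_natCast,
      ← Complex.ofReal_mul, Complex.ofReal_re]
  have hGpos : ∀ x : ℝ, 0 ≤ x → ((x : ℂ) • typeMatrix d k).PosSemidef := fun x hx => by
    rw [Complex.coe_smul]
    exact (posSemidef_typeMatrix d k).smul hx
  have hHtr : (haarMoment d k - (c : ℂ) • typeMatrix d k).trace.re =
      1 - c * d.descFactorial k := by
    rw [Matrix.trace_sub, Complex.sub_re, hG, trace_haarMoment, Complex.one_re]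
  have hPtr : (injectiveSubsetMoment d s k - (l : ℂ) • typeMatrix d k).trace.re ≤
      1 - l * d.descFactorial k := by
    rw [Matrix.trace_sub, Complex.sub_re, hG]
    linarith [(trace_injectiveSubsetMoment_re_mem (k := k) hs1 hs).2]
  have hHtr0 := (Complex.le_def.1 hHc.trace_nonneg).1
  have hPtr0 := (Complex.le_def.1 hPl.trace_nonneg).1
  rw [Complex.zero_re] at hHtr0 hPtr0
  -- The multiple `(c - l) • G` is split into positive and negative parts, so the sign of `c - l`
  -- need not be known.
  have hdec : haarMoment d k - subsetMoment d s k =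
      ((haarMoment d k - (c : ℂ) • typeMatrix d k) + Y + ((max (c - l) 0 : ℝ) : ℂ) •
        typeMatrix d k) - ((injectiveSubsetMoment d s k - (l : ℂ) • typeMatrix d k) + X +
        ((max (l - c) 0 : ℝ) : ℂ) • typeMatrix d k) := by
    have hmax : (c : ℂ) - l = ((max (c - l) 0 : ℝ) : ℂ) - ((max (l - c) 0 : ℝ) : ℂ) := by
      rw [← Complex.ofReal_sub, ← Complex.ofReal_sub, Complex.ofReal_inj]
      rcases le_total c l with h | h
      · rw [max_eq_right (by linarith), max_eq_left (by linarith)]; ring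
      · rw [max_eq_left (by linarith), max_eq_right (by linarith)]; ring
    have h1 : subsetMoment d s k = injectiveSubsetMoment d s k + (X - Y) := by
      rw [← hXY]; abel
    have h2 : ((c : ℂ) - l) • typeMatrix d k = ((max (c - l) 0 : ℝ) : ℂ) • typeMatrix d k -
        ((max (l - c) 0 : ℝ) : ℂ) • typeMatrix d k := by rw [hmax, sub_smul]
    rw [sub_smul] at h2
    rw [h1, ← sub_eq_zero]
    rw [← sub_eq_zero] at h2
    rw [← h2]
    abel
  rw [hdec]
  refine (traceNorm_sub_le ((hHc.add hY).add (hGpos _ (le_max_right _ _)))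
    ((hPl.add hX).add (hGpos _ (le_max_right _ _)))).trans ?_
  simp only [Matrix.trace_add, Complex.add_re, hG, hHtr]
  have hg : (0 : ℝ) ≤ d.descFactorial k := Nat.cast_nonneg _
  -- The left side is `|c - l| · tr G`. Both `c · tr G` and `l · tr G` are at most 1, so their
  -- distance is at most the sum of their gaps to 1.
  have hmax : max (c - l) 0 * (d.descFactorial k : ℝ) + max (l - c) 0 * d.descFactorial k ≤
      (1 - c * d.descFactorial k) + (1 - l * d.descFactorial k) := by
    rcases le_total c l with h | h
    · rw [max_eq_right (by linarith), max_eq_left (by linarith)]; linarith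
    · rw [max_eq_left (by linarith), max_eq_right (by linarith)]; linarith
  rw [mul_div_assoc] at hc
  linarith

theorem mainTheorem1 :
    ∃ C : ℝ, 0 < C ∧ ∀ d s k : ℕ, 1 ≤ s → s ≤ d →
      traceNorm (haarMoment d k - subsetMoment d s k) ≤
        C * ((k : ℝ) ^ 2 / d + (k : ℝ) / Real.sqrt s + (s : ℝ) * k / d) := by
  -- If one of the three terms is at least `1/4`, then 8 times it exceeds or equals the trivial
  -- bound 2. Otherwise the coefficients 6, 3 + 2 and 4 of the main estimate suffice, since `k²/s ≤
  -- k/√s` when `k² ≤ s`.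
  refine ⟨8, by norm_num, fun d s k hs1 hs => ?_⟩
  have hd : (0 : ℝ) < d := by exact_mod_cast (by omega : 0 < d)
  have hs0 : (0 : ℝ) < s := by exact_mod_cast hs1
  have hx : 0 ≤ (k : ℝ) ^ 2 / d := by positivity
  have hy : 0 ≤ (k : ℝ) / √(s : ℝ) := by positivity
  have hz : 0 ≤ (s : ℝ) * k / d := by positivity
  have hy2 : ((k : ℝ) / √(s : ℝ)) ^ 2 = (k : ℝ) ^ 2 / s := by
    rw [div_pow, Real.sq_sqrt hs0.le]
  have htwo := traceNorm_haarMoment_sub_subsetMoment_le_two k hs1 hs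
  by_cases h1 : k ^ 2 ≤ s
  · by_cases h2 : 4 * k ^ 2 ≤ d
    · by_cases h3 : 4 * (s * k) ≤ d
      · have hkk : k ≤ k ^ 2 := Nat.le_self_pow two_ne_zero k
        have hsk : k + s ≤ d := by
          rcases Nat.eq_zero_or_pos k with rfl | hk
          · simpa using hs
          · nlinarith
        refine (traceNorm_haarMoment_sub_subsetMoment_le hs1 hs (by omega) h1 hsk).trans ?_
        have hy1 : (k : ℝ) / √(s : ℝ) ≤ 1 := by
          rw [← sq_le_one_iff₀ hy, hy2, div_le_one hs0]
          exact_mod_cast h1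
        rw [← hy2]
        nlinarith
      · have : (1 / 4 : ℝ) ≤ (s : ℝ) * k / d := by
          rw [le_div_iff₀ hd]
          have : (d : ℝ) < 4 * (s * k) := by exact_mod_cast not_le.1 h3
          linarith
        linarith
    · have : (1 / 4 : ℝ) ≤ (k : ℝ) ^ 2 / d := by
        rw [le_div_iff₀ hd]
        have : (d : ℝ) < 4 * (k : ℝ) ^ 2 := by exact_mod_cast not_le.1 h2
        linarith
      linarith
  · have : 1 ≤ (k : ℝ) / √(s : ℝ) := by
      rw [← one_le_sq_iff₀ hy, hy2, one_le_div hs0]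
      exact_mod_cast (not_le.1 h1).le
    linarith
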